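/- **Setting.** Let $\bm x_1,\dots,\bm x_N\in\mathbb R^d\setminus\{\bm 0\}$ with $\|\bm x_i\|\le R$ for all $i$, let $y_i\in\mathbb R$, and let $\ell:\mathbb R\times\mathbb R\to\mathbb R$ be such that every $\ell_i:=\ell(\cdot,y_i)$ is differentiable and $L_\ell$-Lipschitz with $L_{\ell'}$-Lipschitz derivative. For $\theta=(u_1,\bm w_1,\dots,u_H,\bm w_H)\in(\mathbb R\times\mathbb R^d)^H$ (Euclidean norm) let $$L(\theta)=\sum_{i=1}^N\ell_i\Big(\sum_{k=1}^H u_k\max\{\bm w_k^\top\bm x_i,0\}\Big),\qquad \rho_i(\theta)=\ell_i'\Big(\sum_{k=1}^H u_k\max\{\bm w_k^\top\bm x_i,0\}\Big).$$ The Fréchet subdifferential is $\widehat\partial L(\theta)=\{\bm s:\ \bm s^\top\bm v\le L'(\theta;\bm v)\text{ for all }\bm v\}$, where $L'(\theta;\bm v)$ is the one-sided directional derivative; $\mathrm{dist}(\bm 0,S)=\inf_{\bm s\in S}\|\bm s\|$, which is $+\infty$ if $S=\emptyset$; $\theta$ is $\varepsilon$-Fréchet stationary if $\mathrm{dist}(\bm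 0,\widehat\partial L(\theta))\le\varepsilon$. The Span Qualification (SQ) holds at $\theta$ if for every $k$ $$\mathrm{span}\{\bm x_i:\bm w_k^\top\bm x_i=0,\ u_k\rho_i(\theta)\ge0\}\cap\mathrm{span}\{\bm x_i:\bm w_k^\top\bm x_i=0,\ u_k\rho_i(\theta)<0\}=\{\bm 0\}.$$ **Constants.** Let $\theta^*=(u_1^*,\bm w_1^*,\dots,u_H^*,\bm w_H^*)$, $B\ge\|\theta^*\|$, $\rho_i^*=\rho_i(\theta^*)$, $C_u=L_{\ell'}(4HRB^2+1)$ and $$C_\tau=\min\Big\{\min_{i,k:\ \bm x_i^\top\bm w_k^*\ne0}\frac{|\bm x_i^\top\bm w_k^*|}{4R},\ \min_{i,k:\ \bm x_i^\top\bm w_k^*=0,\ u_k^*\rho_i^*>0}\frac{u_k^*\rho_i^*}{4C_u}\Big\}\in[0,+\infty],$$ with $\min\emptyset=+\infty$ and $a/0=+\infty$ for $a>0$. With $C_1=4L_{\ell'}NHBR$, $C_2=BRC_1$, $C_3=2L_\ell NR$ let $$C_\mu=H(C_2+C_3)+H(BRC_1+2NRL_\ell)=8L_{\ell'}NH^2B^2R^2+4HNRL_\ell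 .$$ **Rounding (Rnd-F).** Given $\theta$ and $\delta>0$, for each $k$ let $\widehat{\bm w}_k$ be the minimizer of $\|\bm z-\bm w_k\|^2$ over all $\bm z\in\mathbb R^d$ such that, for all $i$: $\bm z^\top\bm x_i\ge2R\delta$ if $\bm x_i^\top\bm w_k>R\delta$; $\bm z^\top\bm x_i\le-2R\delta$ if $\bm x_i^\top\bm w_k<-R\delta$; $\bm z^\top\bm x_i=0$ if $|\bm x_i^\top\bm w_k|\le R\delta$. Let $\widehat u_k=0$ if there is an $i$ with $\widehat{\bm w}_k^\top\bm x_i=0$ and $u_k\rho_i(\theta)\le2C_u\delta$, and $\widehat u_k=u_k$ otherwise. The output is $\widehat\theta=(\widehat u_1,\widehat{\bm w}_1,\dots,\widehat u_H,\widehat{\bm w}_H)$. **Theorem (Robust Fréchet test).** Let $\varepsilon\ge0$ and let $\theta^*$ be an $\varepsilon$-Fréchet stationary point of $L$ which satisfies SQ and the nondegeneracy condition: $\rho_i^*\ne0$ whenever $\bm x_i^\top\bm w_k^*=0$ for some $k$. Let $0<\delta\le C_\tau$; in the degenerate case that $\bm x_i^\top\bm w_k^*=0$ for all $i$ and $k$,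 suppose also $\delta\le B/4$ (in every other case this follows from $\delta\le C_\tau$). Then for every $\theta$ with $\|\theta-\theta^*\|\le\delta$ the rounding of $\theta$ has exactly one output $\widehat\theta$, and if $\widehat\theta$ satisfies SQ, then $$\mathrm{dist}\big(\bm 0,\widehat\partial L(\widehat\theta)\big)\le\varepsilon+C_\mu\,\delta .$$ -/

import Mathlib

open scoped NNReal ENNReal Topology

noncomputable section

namespace ReLUNet

/-- Parameters `(u_1, w_1, …, u_H, w_H)` of a two-layer network with `H` hidden nodes and inputs
in `ℝ^d`, with the Euclidean norm and inner product of `ℝ^(H(1+d))`. -/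
abbrev Params (H d : ℕ) : Type :=
  PiLp 2 (fun _ : Fin H => WithLp 2 (ℝ × EuclideanSpace ℝ (Fin d)))

/-- The outer weight `u_k`. -/
def outer {H d : ℕ} (θ : Params H d) (k : Fin H) : ℝ := (θ k).fst

/-- The inner weight vector `w_k`. -/
def hidden {H d : ℕ} (θ : Params H d) (k : Fin H) : EuclideanSpace ℝ (Fin d) := (θ k).snd

/-- The preactivation `w_kᵀ x_i`. -/
def preact {N H d : ℕ} (x : Fin N → EuclideanSpace ℝ (Fin d)) (θ : Params H d)
    (k : Fin H) (i : Fin N) : ℝ :=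
  inner ℝ (hidden θ k) (x i)

/-- The network output `∑ k, u_k * max (w_kᵀ x_i) 0` at the data point `x_i`. -/
def netOut {N H d : ℕ} (x : Fin N → EuclideanSpace ℝ (Fin d)) (θ : Params H d) (i : Fin N) : ℝ :=
  ∑ k, outer θ k * max (preact x θ k i) 0

/-- The empirical loss `∑ i, ℓ (netOut x_i, y_i)`. -/
def empLoss {N H d : ℕ} (ℓ : ℝ → ℝ → ℝ) (x : Fin N → EuclideanSpace ℝ (Fin d)) (y : Fin N → ℝ)
    (θ : Params H d) : ℝ :=
  ∑ i, ℓ (netOut x θ i) (y i)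

/-- `ρ_i = ℓ_i' (netOut x_i)`, where `ℓ_i = ℓ (·, y_i)`. -/
def rho {N H d : ℕ} (ℓ : ℝ → ℝ → ℝ) (x : Fin N → EuclideanSpace ℝ (Fin d)) (y : Fin N → ℝ)
    (θ : Params H d) (i : Fin N) : ℝ :=
  deriv (fun t => ℓ t (y i)) (netOut x θ i)

/-- `I_k^+ = {i : w_kᵀ x_i = 0, u_k ρ_i ≥ 0}`. -/
def idxPos {N H d : ℕ} (ℓ : ℝ → ℝ → ℝ) (x : Fin N → EuclideanSpace ℝ (Fin d)) (y : Fin N → ℝ)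
    (θ : Params H d) (k : Fin H) : Set (Fin N) :=
  {i | preact x θ k i = 0 ∧ 0 ≤ outer θ k * rho ℓ x y θ i}

/-- `I_k^- = {i : w_kᵀ x_i = 0, u_k ρ_i < 0}`. -/
def idxNeg {N H d : ℕ} (ℓ : ℝ → ℝ → ℝ) (x : Fin N → EuclideanSpace ℝ (Fin d)) (y : Fin N → ℝ)
    (θ : Params H d) (k : Fin H) : Set (Fin N) :=
  {i | preact x θ k i = 0 ∧ outer θ k * rho ℓ x y θ i < 0}

/-- Span Qualification: for every hidden node `k`, the spans of the data points indexed by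
`I_k^+` and by `I_k^-` meet only in `0`. -/
def SpanQualification {N H d : ℕ} (ℓ : ℝ → ℝ → ℝ) (x : Fin N → EuclideanSpace ℝ (Fin d))
    (y : Fin N → ℝ) (θ : Params H d) : Prop :=
  ∀ k, Submodule.span ℝ (x '' idxPos ℓ x y θ k) ⊓ Submodule.span ℝ (x '' idxNeg ℓ x y θ k) = ⊥

/-- Nondegeneracy: `ρ_i ≠ 0` for every data point `x_i` with `min_k |w_kᵀ x_i| = 0`. -/
def Nondegenerate {N H d : ℕ} (ℓ : ℝ → ℝ → ℝ) (x : Fin N → EuclideanSpace ℝ (Fin d))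
    (y : Fin N → ℝ) (θ : Params H d) : Prop :=
  ∀ i, (∃ k, preact x θ k i = 0) → rho ℓ x y θ i ≠ 0

/-- `l` is the one-sided directional derivative `f'(p; v)`. -/
def HasDirDeriv {E : Type*} [NormedAddCommGroup E] [InnerProductSpace ℝ E]
    (f : E → ℝ) (p v : E) (l : ℝ) : Prop :=
  Filter.Tendsto (fun t : ℝ => (f (p + t • v) - f p) / t) (𝓝[>] 0) (𝓝 l)

/-- The Fréchet subdifferential of a locally Lipschitz, directionally differentiable function:
all `s` with `⟨s, v⟩ ≤ f'(p; v)` for every direction `v`. -/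
def frechetSubdiff {E : Type*} [NormedAddCommGroup E] [InnerProductSpace ℝ E]
    (f : E → ℝ) (p : E) : Set E :=
  {s | ∀ v, ∃ l, HasDirDeriv f p v l ∧ inner ℝ s v ≤ l}

/-- `p` is an `ε`-Fréchet stationary point of `f`: the distance from `0` to the Fréchet
subdifferential, which is `∞` if the latter is empty, is at most `ε`. -/
def IsFrechetStationary {E : Type*} [NormedAddCommGroup E] [InnerProductSpace ℝ E]
    (f : E → ℝ) (ε : ℝ) (p : E) : Prop :=
  Metric.infEDist 0 (frechetSubdiff f p) ≤ ENNReal.ofReal ε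

/-- `C_u = L_ℓ' (4 H R B² + 1)`. -/
def constCu (H : ℕ) (R B : ℝ) (Lgrad : ℝ≥0) : ℝ := Lgrad * (4 * H * R * B ^ 2 + 1)

/-- The feasible set of the quadratic program that rounds the weight vector `w`. -/
def roundFeasible {N d : ℕ} (x : Fin N → EuclideanSpace ℝ (Fin d)) (R δ : ℝ)
    (w : EuclideanSpace ℝ (Fin d)) : Set (EuclideanSpace ℝ (Fin d)) :=
  {z | (∀ i, R * δ < inner ℝ w (x i) → 2 * R * δ ≤ inner ℝ z (x i)) ∧
    (∀ i, inner ℝ w (x i) < -(R * δ) → inner ℝ z (x i) ≤ -(2 * R * δ)) ∧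
    (∀ i, |inner ℝ w (x i)| ≤ R * δ → inner ℝ z (x i) = 0)}

open Classical in
/-- `θ'` is an output of the Fréchet neural rounding of `θ` with radius `δ`: every `ŵ_k` minimizes
`‖z - w_k‖²` over the feasible set, and `û_k` is `0` if `u_k ρ_i ≤ 2 C_u δ` for some `i` with
`ŵ_kᵀ x_i = 0` (here `ρ_i` is taken at the input `θ`), and `u_k` otherwise. -/
def IsRndFOutput {N H d : ℕ} (ℓ : ℝ → ℝ → ℝ) (x : Fin N → EuclideanSpace ℝ (Fin d))
    (y : Fin N → ℝ) (R B : ℝ) (Lgrad : ℝ≥0) (δ : ℝ) (θ θ' : Params H d) : Prop :=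
  ∀ k,
    (hidden θ' k ∈ roundFeasible x R δ (hidden θ k) ∧
      ∀ z ∈ roundFeasible x R δ (hidden θ k),
        ‖hidden θ' k - hidden θ k‖ ^ 2 ≤ ‖z - hidden θ k‖ ^ 2) ∧
    outer θ' k =
      if ∃ i, preact x θ' k i = 0 ∧ outer θ k * rho ℓ x y θ i ≤ 2 * constCu H R B Lgrad * δ
      then 0 else outer θ k

/-- The separation constant of the Fréchet test: the minimum of all `|w_kᵀ x_i| / (4R)` with
`w_kᵀ x_i ≠ 0` and all `u_k ρ_i / (4 C_u)` with `w_kᵀ x_i = 0` and `u_k ρ_i > 0`; it is `∞` if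
there are none. -/
def sepConst {N H d : ℕ} (ℓ : ℝ → ℝ → ℝ) (x : Fin N → EuclideanSpace ℝ (Fin d)) (y : Fin N → ℝ)
    (R B : ℝ) (Lgrad : ℝ≥0) (θ : Params H d) : ℝ≥0∞ :=
  min
    (⨅ (i : Fin N) (k : Fin H) (_ : preact x θ k i ≠ 0),
      ENNReal.ofReal |preact x θ k i| / ENNReal.ofReal (4 * R))
    (⨅ (i : Fin N) (k : Fin H) (_ : preact x θ k i = 0 ∧ 0 < outer θ k * rho ℓ x y θ i),
      ENNReal.ofReal (outer θ k * rho ℓ x y θ i) / ENNReal.ofReal (4 * constCu H R B Lgrad))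

/-- The curvature constant of the Fréchet test, `H (C₂ + C₃) + H (B R C₁ + 2 N R L_ℓ)` with
`C₁ = 4 L_ℓ' N H B R`, `C₂ = B R C₁` and `C₃ = 2 L_ℓ N R`. -/
def curvConst (N H : ℕ) (R B : ℝ) (Lloss Lgrad : ℝ≥0) : ℝ :=
  let C₁ : ℝ := 4 * Lgrad * N * H * B * R
  let C₂ : ℝ := B * R * C₁
  let C₃ : ℝ := 2 * Lloss * N * R
  H * (C₂ + C₃) + H * (B * R * C₁ + 2 * N * R * Lloss)

end ReLUNet

end

namespace ReLUNet

/-! ### One-sided derivatives and the node-by-node form of the subdifferential. -/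

section

/-! The subdifferential splits over the nodes (`mem_frechetSubdiff_iff`): the outer component is a
fixed number, and the inner component at node `k` is any linear minorant of a sum of rectifier
derivatives with coefficients `u_k ρ_i`. By separation, such a minorant is a combination of the
`x_i` weighted by rectifier subgradients (`exists_subgradient_representation`). Conversely, such a
combination is a minorant once the coefficients at the kinks are nonnegative.

At `θ*` the subdifferential is nonempty, so SQ makes those coefficients nonnegative
(`coeff_nonneg_of_linear_minorant`), and nondegeneracy makes them positive unless `u_k* = 0`. The
separation constant lets the rounding recover the activation pattern of `θ*` exactly
(`mem_roundFeasible_of_near`). An outer weight is erased only if it is already `O(δ)`, and the kink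
coefficients of the surviving ones stay nonnegative (`outer_small_of_mul_le`,
`isRndFOutput_bounds`).

Hence each subgradient at `θ*` can be carried to the rounded point with the same rectifier weights,
and only `u` and `ρ` change in its coefficients. The displacement is at most `C_μ δ`
(`exists_subgradient_near`), which bounds the change in the distance from `0`. -/

/-- The right derivative of `t ↦ max (a + t b) 0` at `0`. -/
noncomputable def reluDirDeriv (a b : ℝ) : ℝ := if 0 < a then b else if a = 0 then max b 0 else 0

/-- Treating one-sided derivatives as derivatives within `Set.Ioi 0` makes the sum, product and
chain rules available for the whole loss. -/
theorem hasDerivWithinAt_relu (a b : ℝ) :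
    HasDerivWithinAt (fun t : ℝ => max (a + t * b) 0) (reluDirDeriv a b) (Set.Ioi 0) 0 := by
  have hc : Filter.Tendsto (fun t : ℝ => a + t * b) (𝓝[>] 0) (𝓝 a) := by
    have : Continuous fun t : ℝ => a + t * b := by fun_prop
    simpa using (this.tendsto 0).mono_left nhdsWithin_le_nhds
  unfold reluDirDeriv
  rcases lt_trichotomy a 0 with h | h | h
  · rw [if_neg (by linarith), if_neg (by linarith)]
    refine (hasDerivWithinAt_const (0 : ℝ) (Set.Ioi 0) (0 : ℝ)).congr_of_eventuallyEq ?_ ?_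
    · filter_upwards [hc.eventually (gt_mem_nhds h)] with t ht
      exact max_eq_right ht.le
    · simpa using h.le
  · subst h
    rw [if_neg (lt_irrefl _), if_pos rfl]
    have : HasDerivWithinAt (fun t : ℝ => t * max b 0) (1 * max b 0) (Set.Ioi 0) 0 :=
      (hasDerivWithinAt_id _ _).mul_const _
    rw [one_mul] at this
    refine this.congr_of_eventuallyEq ?_ (by simp)
    filter_upwards [self_mem_nhdsWithin] with t ht
    have ht : (0 : ℝ) < t := ht
    rcases le_total b 0 with hb | hb
    · simp [hb, mul_nonpos_of_nonneg_of_nonpos ht.le hb]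
    · simp [hb, mul_nonneg ht.le hb]
  · rw [if_pos h]
    have : HasDerivWithinAt (fun t : ℝ => a + t * b) (1 * b) (Set.Ioi 0) 0 :=
      ((hasDerivWithinAt_id _ _).mul_const _).const_add _
    rw [one_mul] at this
    refine this.congr_of_eventuallyEq ?_ ?_
    · filter_upwards [hc.eventually (lt_mem_nhds h)] with t ht
      exact max_eq_left ht.le
    · simpa using h.le

variable {N H d : ℕ} {ℓ : ℝ → ℝ → ℝ} {x : Fin N → EuclideanSpace ℝ (Fin d)} {y : Fin N → ℝ}

theorem outer_add_smul (θ v : Params H d) (t : ℝ) (k : Fin H) :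
    outer (θ + t • v) k = outer θ k + t * outer v k := by
  simp [outer]

theorem preact_add_smul (θ v : Params H d) (t : ℝ) (k : Fin H) (i : Fin N) :
    preact x (θ + t • v) k i = preact x θ k i + t * preact x v k i := by
  simp [preact, hidden, inner_add_left, inner_smul_left]

/-- The one-sided directional derivative of the network output. -/
noncomputable def netDirDeriv (x : Fin N → EuclideanSpace ℝ (Fin d)) (θ v : Params H d)
    (i : Fin N) : ℝ :=
  ∑ k, (outer v k * max (preact x θ k i) 0 + outer θ k * reluDirDeriv (preact x θ k i) (preact x v k i))

theorem hasDerivWithinAt_netOut (θ v : Params H d) (i : Fin N) :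
    HasDerivWithinAt (fun t : ℝ => netOut x (θ + t • v) i) (netDirDeriv x θ v i) (Set.Ioi 0) 0 := by
  unfold netOut netDirDeriv
  refine HasDerivWithinAt.fun_sum fun k _ => ?_
  simp only [outer_add_smul, preact_add_smul]
  have h1 : HasDerivWithinAt (fun t : ℝ => outer θ k + t * outer v k) (1 * outer v k)
      (Set.Ioi 0) 0 := ((hasDerivWithinAt_id _ _).mul_const _).const_add _
  simpa using h1.fun_mul (hasDerivWithinAt_relu (preact x θ k i) (preact x v k i))

theorem hasDirDeriv_empLoss (hdiff : ∀ i, Differentiable ℝ (fun t => ℓ t (y i)))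
    (θ v : Params H d) :
    HasDirDeriv (empLoss ℓ x y) θ v (∑ i, rho ℓ x y θ i * netDirDeriv x θ v i) := by
  have h : HasDerivWithinAt (fun t : ℝ => empLoss ℓ x y (θ + t • v))
      (∑ i, rho ℓ x y θ i * netDirDeriv x θ v i) (Set.Ioi 0) 0 := by
    unfold empLoss
    refine HasDerivWithinAt.fun_sum fun i _ => ?_
    have h2 := (hdiff i (netOut x (θ + (0 : ℝ) • v) i)).hasDerivAt
    have := h2.comp_hasDerivWithinAt (0 : ℝ) (hasDerivWithinAt_netOut (x := x) θ v i)
    simpa [rho, Function.comp_def] using this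
  rw [hasDerivWithinAt_iff_tendsto_slope' (by simp)] at h
  refine h.congr fun t => ?_
  simp [slope, div_eq_inv_mul]

theorem mem_frechetSubdiff_iff_forall (hdiff : ∀ i, Differentiable ℝ (fun t => ℓ t (y i)))
    (θ s : Params H d) :
    s ∈ frechetSubdiff (empLoss ℓ x y) θ ↔
      ∀ v, inner ℝ s v ≤ ∑ i, rho ℓ x y θ i * netDirDeriv x θ v i := by
  refine ⟨fun h v => ?_, fun h v => ⟨_, hasDirDeriv_empLoss hdiff θ v, h v⟩⟩
  obtain ⟨l, hl, hle⟩ := h v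
  exact hle.trans (tendsto_nhds_unique hl (hasDirDeriv_empLoss hdiff θ v)).le

theorem inner_params (s v : Params H d) :
    inner ℝ s v = ∑ k, (outer s k * outer v k + inner ℝ (hidden s k) (hidden v k)) := by
  simp [PiLp.inner_apply, outer, hidden, mul_comm]

/-- The parameter vector with outer weights `u` and inner weights `w`. -/
noncomputable def mkParams (u : Fin H → ℝ) (w : Fin H → EuclideanSpace ℝ (Fin d)) : Params H d :=
  WithLp.toLp 2 fun k => WithLp.toLp 2 (u k, w k)

@[simp] theorem outer_mkParams (u : Fin H → ℝ) (w : Fin H → EuclideanSpace ℝ (Fin d))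
    (k : Fin H) : outer (mkParams u w) k = u k := rfl

@[simp] theorem hidden_mkParams (u : Fin H → ℝ) (w : Fin H → EuclideanSpace ℝ (Fin d))
    (k : Fin H) : hidden (mkParams u w) k = w k := rfl

@[simp] theorem preact_mkParams (u : Fin H → ℝ) (w : Fin H → EuclideanSpace ℝ (Fin d))
    (k : Fin H) (i : Fin N) : preact x (mkParams u w) k i = inner ℝ (w k) (x i) := rfl

theorem params_ext {θ θ' : Params H d} (hu : ∀ k, outer θ k = outer θ' k)
    (hw : ∀ k, hidden θ k = hidden θ' k) : θ = θ' := by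
  ext k : 1
  exact (WithLp.ofLp_injective 2) (Prod.ext (hu k) (hw k))

theorem reluDirDeriv_zero (a : ℝ) : reluDirDeriv a 0 = 0 := by
  simp [reluDirDeriv]

theorem sum_rho_mul_netDirDeriv (θ v : Params H d) :
    ∑ i, rho ℓ x y θ i * netDirDeriv x θ v i =
      ∑ k, (outer v k * ∑ i, rho ℓ x y θ i * max (preact x θ k i) 0 +
        ∑ i, outer θ k * rho ℓ x y θ i * reluDirDeriv (preact x θ k i) (preact x v k i)) := by
  simp only [netDirDeriv, Finset.mul_sum]
  rw [Finset.sum_comm]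
  refine Finset.sum_congr rfl fun k _ => ?_
  rw [← Finset.sum_add_distrib]
  exact Finset.sum_congr rfl fun i _ => by ring

/-- The Fréchet subdifferential is a product over the weights of the network. -/
theorem mem_frechetSubdiff_iff (hdiff : ∀ i, Differentiable ℝ (fun t => ℓ t (y i)))
    (θ s : Params H d) :
    s ∈ frechetSubdiff (empLoss ℓ x y) θ ↔
      ∀ k, outer s k = ∑ i, rho ℓ x y θ i * max (preact x θ k i) 0 ∧
        ∀ v, inner ℝ (hidden s k) v ≤
          ∑ i, outer θ k * rho ℓ x y θ i * reluDirDeriv (preact x θ k i) (inner ℝ v (x i)) := by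
  rw [mem_frechetSubdiff_iff_forall hdiff]
  simp only [inner_params, sum_rho_mul_netDirDeriv]
  constructor
  · intro h k
    -- Directions supported on the single node `k` isolate its two components.
    have hs : ∀ (a : ℝ) (v : EuclideanSpace ℝ (Fin d)),
        outer s k * a + inner ℝ (hidden s k) v ≤
          a * ∑ i, rho ℓ x y θ i * max (preact x θ k i) 0 +
          ∑ i, outer θ k * rho ℓ x y θ i * reluDirDeriv (preact x θ k i) (inner ℝ v (x i)) := by
      intro a v
      have := h (mkParams (Pi.single k a) (Pi.single k v))
      rw [Finset.sum_eq_single k, Finset.sum_eq_single k] at this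
      · simpa using this
      · intro j _ hj
        simp [Pi.single_eq_of_ne hj, reluDirDeriv_zero]
      · simp
      · intro j _ hj
        simp [Pi.single_eq_of_ne hj]
      · simp
    refine ⟨?_, fun v => by simpa using hs 0 v⟩
    -- The directional derivative is linear in the outer weight, so the directions `±1` turn the
    -- inequality into an equality.
    have h1 := hs 1 0
    have h2 := hs (-1) 0
    simp only [inner_zero_right, inner_zero_left, reluDirDeriv_zero, mul_zero,
      Finset.sum_const_zero, add_zero] at h1 h2
    linarith
  · intro h v
    refine Finset.sum_le_sum fun k _ => add_le_add ?_ ((h k).2 _)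
    rw [(h k).1, mul_comm]

end

/-! ### Rectifier subgradients, and projection onto the rounding constraints. -/

section

variable {N H d : ℕ} {x : Fin N → EuclideanSpace ℝ (Fin d)}

/-- Adding opposite directions cancels every linear contribution, so only kinks remain visible. -/
theorem reluDirDeriv_add_neg (a b : ℝ) :
    reluDirDeriv a b + reluDirDeriv a (-b) = if a = 0 then |b| else 0 := by
  unfold reluDirDeriv
  split_ifs with h1 h2 h2
  · linarith
  · ring
  · rcases le_total b 0 with hb | hb
    · rw [max_eq_right hb, max_eq_left (by linarith), abs_of_nonpos hb, zero_add]
    · rw [max_eq_left hb, max_eq_right (by linarith), abs_of_nonneg hb, add_zero]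
  · simp

/-- If a positively homogeneous sum of rectified terms has a linear minorant and the data points
with negative coefficients are separated from the others, there are no negative coefficients. -/
theorem coeff_nonneg_of_linear_minorant (hx : ∀ i, x i ≠ 0) {a c : Fin N → ℝ}
    {s : EuclideanSpace ℝ (Fin d)}
    (hs : ∀ v, inner ℝ s v ≤ ∑ i, c i * reluDirDeriv (a i) (inner ℝ v (x i)))
    (hspan : Submodule.span ℝ (x '' {i | a i = 0 ∧ 0 ≤ c i}) ⊓
      Submodule.span ℝ (x '' {i | a i = 0 ∧ c i < 0}) = ⊥) {j : Fin N} (hj : a j = 0) :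
    0 ≤ c j := by
  by_contra! hneg
  set S := Submodule.span ℝ (x '' {i | a i = 0 ∧ 0 ≤ c i})
  -- The component `p` of `x j` orthogonal to `S` is blind to the points with nonnegative
  -- coefficients but sees `x j`, which lies outside `S` by `hspan`. Testing `p` and `-p` then gives
  -- `0 ≤` a negative sum.
  obtain ⟨q, hq, p, hp, hqp⟩ := S.exists_add_mem_mem_orthogonal (x j)
  have hpj : inner ℝ p (x j) ≠ 0 := by
    rw [hqp, inner_add_right, S.inner_left_of_mem_orthogonal hq hp, zero_add, inner_self_ne_zero]
    rintro rfl
    rw [add_zero] at hqp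
    refine hx j ((Submodule.mem_bot ℝ).1 (hspan ▸ Submodule.mem_inf.2 ⟨hqp ▸ hq, ?_⟩))
    exact Submodule.subset_span ⟨j, ⟨hj, hneg⟩, rfl⟩
  have h := add_le_add (hs p) (hs (-p))
  simp only [inner_neg_right, inner_neg_left, add_neg_cancel, ← Finset.sum_add_distrib,
    ← mul_add, reluDirDeriv_add_neg] at h
  refine absurd h (not_le.2 (Finset.sum_neg' (fun i _ => ?_) ⟨j, Finset.mem_univ _, ?_⟩))
  · split_ifs with hi
    · rcases le_or_gt 0 (c i) with hc | hc
      · have : inner ℝ p (x i) = 0 :=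
          S.inner_left_of_mem_orthogonal (Submodule.subset_span ⟨i, ⟨hi, hc⟩, rfl⟩) hp
        simp [this]
      · exact mul_nonpos_of_nonpos_of_nonneg hc.le (abs_nonneg _)
    · simp
  · rw [if_pos hj]
    exact mul_neg_of_neg_of_pos hneg (abs_pos.2 hpj)

/-- `lam` is a subgradient of the rectifier at `a`. -/
def IsReluSubgradient (a lam : ℝ) : Prop :=
  0 ≤ lam ∧ lam ≤ 1 ∧ (0 < a → lam = 1) ∧ (a < 0 → lam = 0)

/-- Away from the kink both sides agree whatever the sign of `c`; only at the kink is convexity,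
hence `0 ≤ c`, needed. -/
theorem IsReluSubgradient.mul_le {a lam : ℝ} (h : IsReluSubgradient a lam) {c b : ℝ}
    (hc : a = 0 → 0 ≤ c) : c * (lam * b) ≤ c * reluDirDeriv a b := by
  obtain ⟨h0, h1, hp, hn⟩ := h
  unfold reluDirDeriv
  rcases lt_trichotomy a 0 with h | h | h
  · simp [hn h, h.not_gt, h.ne]
  · rw [if_neg h.not_gt, if_pos h]
    refine mul_le_mul_of_nonneg_left ?_ (hc h)
    rcases le_total b 0 with hb | hb
    · exact (mul_nonpos_of_nonneg_of_nonpos h0 hb).trans (le_max_right _ _)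
    · exact (mul_le_of_le_one_left hb h1).trans (le_max_left _ _)
  · simp [hp h, h]

/-- Subgradient weights survive a change of activation that keeps each sign or collapses it to a
kink. -/
theorem IsReluSubgradient.congr {a a' lam : ℝ} (h : IsReluSubgradient a lam)
    (hp : 0 < a' → 0 < a) (hn : a' < 0 → a < 0) : IsReluSubgradient a' lam :=
  ⟨h.1, h.2.1, fun h' => h.2.2.1 (hp h'), fun h' => h.2.2.2 (hn h')⟩

/-- The one-sided derivative is attained by some weight, exactly; this lets the separation argument
work for coefficients of either sign. -/
theorem exists_isReluSubgradient_mul_eq (a b : ℝ) :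
    ∃ lam, IsReluSubgradient a lam ∧ lam * b = reluDirDeriv a b := by
  unfold reluDirDeriv
  rcases lt_trichotomy a 0 with h | h | h
  · exact ⟨0, ⟨le_rfl, zero_le_one, fun h' => absurd h h'.not_gt, fun _ => rfl⟩,
      by simp [h.not_gt, h.ne]⟩
  · rw [if_neg h.not_gt, if_pos h]
    rcases le_total b 0 with hb | hb
    · exact ⟨0, ⟨le_rfl, zero_le_one, fun h' => absurd h h'.ne', fun _ => rfl⟩, by simp [hb]⟩
    · exact ⟨1, ⟨zero_le_one, le_rfl, fun _ => rfl, fun h' => absurd h h'.ne⟩, by simp [hb]⟩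
  · exact ⟨1, ⟨zero_le_one, le_rfl, fun _ => rfl, fun h' => absurd h h'.not_gt⟩, by simp [h]⟩

theorem convex_setOf_isReluSubgradient (a : Fin N → ℝ) :
    Convex ℝ {lam : Fin N → ℝ | ∀ i, IsReluSubgradient (a i) (lam i)} := by
  intro p hp q hq s t hs ht hst i
  obtain ⟨p0, p1, pp, pn⟩ := hp i
  obtain ⟨q0, q1, qp, qn⟩ := hq i
  simp only [Pi.add_apply, Pi.smul_apply, smul_eq_mul]
  refine ⟨by positivity, by nlinarith, fun h => ?_, fun h => ?_⟩
  · rw [pp h, qp h, mul_one, mul_one, hst]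
  · rw [pn h, qn h, mul_zero, mul_zero, add_zero]

theorem isCompact_setOf_isReluSubgradient (a : Fin N → ℝ) :
    IsCompact {lam : Fin N → ℝ | ∀ i, IsReluSubgradient (a i) (lam i)} := by
  have hc : ∀ i, IsCompact {t : ℝ | IsReluSubgradient (a i) t} := fun i => by
    refine isCompact_Icc.of_isClosed_subset (t := {t : ℝ | IsReluSubgradient (a i) t})
      (s := Set.Icc (0 : ℝ) 1) ?_ fun t ht => ⟨ht.1, ht.2.1⟩
    refine (isClosed_le continuous_const continuous_id).inter
      ((isClosed_le continuous_id continuous_const).inter (IsClosed.inter ?_ ?_))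
    all_goals
      change IsClosed {t : ℝ | _ → t = _}
      simp only [Set.ofPred_forall]
      exact isClosed_iInter fun _ => isClosed_singleton
  convert isCompact_univ_pi hc using 1
  ext; simp

/-- A linear minorant of a sum of rectified terms is a combination of subgradients. -/
theorem exists_subgradient_representation {a c : Fin N → ℝ} {s : EuclideanSpace ℝ (Fin d)}
    (hs : ∀ v, inner ℝ s v ≤ ∑ i, c i * reluDirDeriv (a i) (inner ℝ v (x i))) :
    ∃ lam : Fin N → ℝ, (∀ i, IsReluSubgradient (a i) (lam i)) ∧
      s = ∑ i, (c i * lam i) • x i := by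
  let T : (Fin N → ℝ) →ₗ[ℝ] EuclideanSpace ℝ (Fin d) :=
    ∑ i, (LinearMap.proj i : (Fin N → ℝ) →ₗ[ℝ] ℝ).smulRight (c i • x i)
  have hT : ∀ lam, T lam = ∑ i, (c i * lam i) • x i := fun lam => by
    simp [T, smul_smul, mul_comm]
  by_contra hcon
  have hnot : s ∉ T '' {lam | ∀ i, IsReluSubgradient (a i) (lam i)} := by
    rintro ⟨lam, hlam, h⟩
    exact hcon ⟨lam, hlam, by rw [← h, hT]⟩
  -- If `s` were outside the compact convex set of combinations, a separating direction `v` would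
  -- exist. The weights attaining the derivative along `v` contradict `hs v`.
  obtain ⟨f, u, hf, hu⟩ := geometric_hahn_banach_closed_point
    ((convex_setOf_isReluSubgradient a).linear_image T)
    ((isCompact_setOf_isReluSubgradient a).image
      (LinearMap.continuous_of_finiteDimensional T)).isClosed hnot
  set v := (InnerProductSpace.toDual ℝ (EuclideanSpace ℝ (Fin d))).symm f
  have hv : ∀ z, f z = inner ℝ v z := fun z => (InnerProductSpace.toDual_symm_apply).symm
  choose lam hlam hmul using fun i => exists_isReluSubgradient_mul_eq (a i) (inner ℝ v (x i))
  have h1 := hf _ ⟨lam, hlam, rfl⟩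
  have h2 := hs v
  rw [hT, hv, inner_sum] at h1
  rw [hv, real_inner_comm] at hu
  simp only [← hmul] at h2
  simp only [inner_smul_right, mul_assoc] at h1
  linarith

/-- A nonempty closed convex set has exactly one point nearest to `w`. -/
theorem existsUnique_nearest {E : Type*} [NormedAddCommGroup E] [InnerProductSpace ℝ E]
    [ProperSpace E] {K : Set E} (hne : K.Nonempty) (hcl : IsClosed K) (hcv : Convex ℝ K) (w : E) :
    ∃! z, z ∈ K ∧ ∀ z' ∈ K, ‖z - w‖ ^ 2 ≤ ‖z' - w‖ ^ 2 := by
  obtain ⟨z, hz, hd⟩ := hcl.exists_infDist_eq_dist hne w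
  refine ⟨z, ⟨hz, fun z' hz' => ?_⟩, ?_⟩
  · have := Metric.infDist_le_dist_of_mem (x := w) hz'
    rw [hd, dist_comm, dist_comm w, dist_eq_norm, dist_eq_norm] at this
    gcongr
  · rintro z' ⟨hz', hmin'⟩
    -- The midpoint of two minimizers is no nearer to `w` than they are, so the parallelogram law
    -- leaves no room for `z ≠ z'`.
    have hm := hmin' _ (hcv hz hz' (by norm_num : (0 : ℝ) ≤ 1 / 2) (by norm_num : (0 : ℝ) ≤ 1 / 2)
      (by norm_num))
    have hzz := hmin' _ hz
    have hle : ‖z - w‖ ≤ ‖z' - w‖ := by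
      have := Metric.infDist_le_dist_of_mem (x := w) hz'
      rwa [hd, dist_comm, dist_comm w, dist_eq_norm, dist_eq_norm] at this
    have hle2 : ‖z - w‖ ^ 2 ≤ ‖z' - w‖ ^ 2 := by gcongr
    have hpar := parallelogram_law_with_norm ℝ (z - w) (z' - w)
    have e1 : (1 / 2 : ℝ) • z + (1 / 2 : ℝ) • z' - w = (1 / 2 : ℝ) • ((z - w) + (z' - w)) := by
      module
    rw [e1, norm_smul, mul_pow] at hm
    norm_num at hm
    rw [sub_sub_sub_cancel_right] at hpar
    have : ‖z - z'‖ = 0 := by nlinarith [norm_nonneg (z - z')]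
    exact (sub_eq_zero.1 (norm_eq_zero.1 this)).symm

theorem convex_roundFeasible (R δ : ℝ) (w : EuclideanSpace ℝ (Fin d)) :
    Convex ℝ (roundFeasible x R δ w) := by
  intro p hp q hq s t hs ht hst
  obtain rfl : t = 1 - s := by linarith
  refine ⟨fun i hi => ?_, fun i hi => ?_, fun i hi => ?_⟩ <;>
    simp only [inner_add_left, real_inner_smul_left]
  · linarith [mul_le_mul_of_nonneg_left (hp.1 i hi) hs, mul_le_mul_of_nonneg_left (hq.1 i hi) ht]
  · linarith [mul_le_mul_of_nonneg_left (hp.2.1 i hi) hs,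
      mul_le_mul_of_nonneg_left (hq.2.1 i hi) ht]
  · rw [hp.2.2 i hi, hq.2.2 i hi]
    simp

theorem isClosed_roundFeasible (R δ : ℝ) (w : EuclideanSpace ℝ (Fin d)) :
    IsClosed (roundFeasible x R δ w) := by
  simp only [roundFeasible, Set.ofPred_and, Set.ofPred_forall]
  refine IsClosed.inter ?_ (IsClosed.inter ?_ ?_)
  · exact isClosed_iInter fun i => isClosed_iInter fun _ =>
      isClosed_le continuous_const (by fun_prop)
  · exact isClosed_iInter fun i => isClosed_iInter fun _ =>
      isClosed_le (by fun_prop) continuous_const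
  · exact isClosed_iInter fun i => isClosed_iInter fun _ =>
      isClosed_eq (by fun_prop) continuous_const

end

/-! ### Perturbation estimates and transport of subgradients. -/

section

variable {N H d : ℕ} {ℓ : ℝ → ℝ → ℝ} {x : Fin N → EuclideanSpace ℝ (Fin d)} {y : Fin N → ℝ}

theorem norm_sq_params_apply (θ : Params H d) (k : Fin H) :
    ‖θ k‖ ^ 2 = outer θ k ^ 2 + ‖hidden θ k‖ ^ 2 := by
  rw [WithLp.prod_norm_sq_eq_of_L2, Real.norm_eq_abs, sq_abs]
  rfl

theorem sq_outer_add_sq_hidden_le (θ : Params H d) (k : Fin H) :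
    outer θ k ^ 2 + ‖hidden θ k‖ ^ 2 ≤ ‖θ‖ ^ 2 := by
  rw [← norm_sq_params_apply]
  gcongr
  exact PiLp.norm_apply_le θ k

theorem abs_outer_le_norm (θ : Params H d) (k : Fin H) : |outer θ k| ≤ ‖θ‖ :=
  abs_le_of_sq_le_sq (by nlinarith [sq_outer_add_sq_hidden_le θ k, norm_nonneg (hidden θ k)])
    (norm_nonneg θ)

theorem norm_hidden_le_norm (θ : Params H d) (k : Fin H) : ‖hidden θ k‖ ≤ ‖θ‖ :=
  le_of_sq_le_sq (by nlinarith [sq_outer_add_sq_hidden_le θ k]) (norm_nonneg θ)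

theorem outer_sub (θ θ' : Params H d) (k : Fin H) :
    outer (θ - θ') k = outer θ k - outer θ' k := rfl

theorem hidden_sub (θ θ' : Params H d) (k : Fin H) :
    hidden (θ - θ') k = hidden θ k - hidden θ' k := rfl

/-- A bound for the norm of a parameter vector from bounds for its nodes. -/
theorem norm_params_le {θ : Params H d} {M : ℝ} (hM : 0 ≤ M)
    (h : ∀ k, outer θ k ^ 2 + ‖hidden θ k‖ ^ 2 ≤ M ^ 2) : ‖θ‖ ≤ H * M := by
  have hk : ∀ k, ‖θ k‖ ≤ M := fun k =>
    le_of_sq_le_sq ((norm_sq_params_apply θ k).trans_le (h k)) hM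
  -- Bounding the Euclidean norm over the nodes by their sum costs the outer factor `H` of `C_μ`.
  have hn : ‖θ‖ ^ 2 ≤ (∑ k, ‖θ k‖) ^ 2 := by
    rw [PiLp.norm_sq_eq_of_L2]
    exact Finset.sum_sq_le_sq_sum_of_nonneg fun k _ => norm_nonneg _
  refine (le_of_sq_le_sq hn (Finset.sum_nonneg fun k _ => norm_nonneg _)).trans ?_
  simpa using Finset.sum_le_sum fun k (_ : k ∈ Finset.univ) => hk k

theorem abs_preact_le {R : ℝ} {i : Fin N} (hR : ‖x i‖ ≤ R) (θ : Params H d) (k : Fin H) :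
    |preact x θ k i| ≤ ‖hidden θ k‖ * R :=
  (abs_real_inner_le_norm _ _).trans (by gcongr)

theorem abs_preact_sub_le {R : ℝ} {i : Fin N} (hR : ‖x i‖ ≤ R) (θ θ' : Params H d) (k : Fin H) :
    |preact x θ k i - preact x θ' k i| ≤ ‖hidden θ k - hidden θ' k‖ * R := by
  unfold preact
  rw [← inner_sub_left]
  exact (abs_real_inner_le_norm _ _).trans (by gcongr)

theorem abs_relu_sub_relu_le (a b : ℝ) : |max a 0 - max b 0| ≤ |a - b| :=
  abs_max_sub_max_le_abs a b 0

/-- The mixed splitting `(u - u') r + u' (r - r')` requires bounds only on the inner weights of one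
point and the outer weights of the other. -/
theorem abs_netOut_sub_le {R : ℝ} {i : Fin N} (hR : ‖x i‖ ≤ R) {θ θ' : Params H d}
    {a b U W : ℝ} (ha : ∀ k, |outer θ k - outer θ' k| ≤ a)
    (hb : ∀ k, ‖hidden θ k - hidden θ' k‖ ≤ b) (hW : ∀ k, ‖hidden θ k‖ ≤ W)
    (hU : ∀ k, |outer θ' k| ≤ U) :
    |netOut x θ i - netOut x θ' i| ≤ H * (R * (a * W + U * b)) := by
  have hR0 : 0 ≤ R := (norm_nonneg _).trans hR
  unfold netOut
  rw [← Finset.sum_sub_distrib]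
  refine (Finset.abs_sum_le_sum_abs _ _).trans ?_
  have hk : ∀ k, |outer θ k * max (preact x θ k i) 0 - outer θ' k * max (preact x θ' k i) 0| ≤
      R * (a * W + U * b) := by
    intro k
    have h1 : |max (preact x θ k i) 0| ≤ W * R := by
      have := abs_relu_sub_relu_le (preact x θ k i) 0
      rw [max_self, sub_zero, sub_zero] at this
      exact (this.trans (abs_preact_le hR θ k)).trans (by gcongr; exact hW k)
    have h2 : |max (preact x θ k i) 0 - max (preact x θ' k i) 0| ≤ b * R :=
      ((abs_relu_sub_relu_le _ _).trans (abs_preact_sub_le hR θ θ' k)).trans (by gcongr; exact hb k)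
    calc _ = |(outer θ k - outer θ' k) * max (preact x θ k i) 0 +
          outer θ' k * (max (preact x θ k i) 0 - max (preact x θ' k i) 0)| := by congr 1; ring
      _ ≤ a * (W * R) + U * (b * R) := by
        refine (abs_add_le _ _).trans (add_le_add ?_ ?_) <;> rw [abs_mul]
        · exact mul_le_mul (ha k) h1 (abs_nonneg _) ((abs_nonneg _).trans (ha k))
        · exact mul_le_mul (hU k) h2 (abs_nonneg _) ((abs_nonneg _).trans (hU k))
      _ = _ := by ring
  simpa using Finset.sum_le_sum fun k (_ : k ∈ Finset.univ) => hk k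

theorem abs_rho_le {Lloss : ℝ≥0} (hloss : ∀ i, LipschitzWith Lloss (fun t => ℓ t (y i)))
    (θ : Params H d) (i : Fin N) : |rho ℓ x y θ i| ≤ Lloss :=
  norm_deriv_le_of_lipschitz (hloss i)

theorem abs_rho_sub_le {Lgrad : ℝ≥0}
    (hgrad : ∀ i, LipschitzWith Lgrad (deriv (fun t => ℓ t (y i))))
    (θ θ' : Params H d) (i : Fin N) :
    |rho ℓ x y θ i - rho ℓ x y θ' i| ≤ Lgrad * |netOut x θ i - netOut x θ' i| :=
  (hgrad i).dist_le_mul _ _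

theorem four_mul_le_abs_preact {R B δ : ℝ} {Lgrad : ℝ≥0} {θ : Params H d} (hR : 0 < R)
    (h : ENNReal.ofReal δ ≤ sepConst ℓ x y R B Lgrad θ) {k : Fin H} {i : Fin N}
    (hki : preact x θ k i ≠ 0) : 4 * R * δ ≤ |preact x θ k i| := by
  have h1 : ENNReal.ofReal δ ≤ ENNReal.ofReal |preact x θ k i| / ENNReal.ofReal (4 * R) :=
    (h.trans (min_le_left _ _)).trans ((iInf_le _ i).trans ((iInf_le _ k).trans (iInf_le _ hki)))
  rw [← ENNReal.ofReal_div_of_pos (by positivity),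
    ENNReal.ofReal_le_ofReal_iff (by positivity), le_div_iff₀ (by positivity)] at h1
  linarith

theorem four_mul_le_outer_mul_rho {R B δ : ℝ} {Lgrad : ℝ≥0} {θ : Params H d}
    (hC : 0 ≤ constCu H R B Lgrad)
    (h : ENNReal.ofReal δ ≤ sepConst ℓ x y R B Lgrad θ) {k : Fin H} {i : Fin N}
    (hki : preact x θ k i = 0) (hpos : 0 < outer θ k * rho ℓ x y θ i) :
    4 * constCu H R B Lgrad * δ ≤ outer θ k * rho ℓ x y θ i := by
  -- If `C_u = 0`, the quotient is infinite and puts no limit on `δ`, but the claim is then trivial.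
  rcases hC.eq_or_lt with h0 | hC
  · rw [← h0]
    simpa using hpos.le
  have h1 : ENNReal.ofReal δ ≤ ENNReal.ofReal (outer θ k * rho ℓ x y θ i) /
      ENNReal.ofReal (4 * constCu H R B Lgrad) :=
    (h.trans (min_le_right _ _)).trans
      ((iInf_le _ i).trans ((iInf_le _ k).trans (iInf_le _ ⟨hki, hpos⟩)))
  rw [← ENNReal.ofReal_div_of_pos (by positivity),
    ENNReal.ofReal_le_ofReal_iff (by positivity), le_div_iff₀ (by positivity)] at h1
  linarith

/-- If `u ρ` falls below half of the separation of `u* ρ*`, then both weights are small. -/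
theorem outer_small_of_mul_le {us u rs r c δ : ℝ} (hδ : 0 ≤ δ)
    (hus : us ≠ 0 → 0 < us * rs ∧ 4 * c ≤ us * rs) (hu : |u - us| ≤ δ)
    (hr : |us| * |r - rs| ≤ c) (hle : u * r ≤ 2 * c) : |u| ≤ 2 * δ ∧ |us| ≤ 3 * δ := by
  obtain ⟨hu1, hu2⟩ := abs_le.1 hu
  by_cases h0 : us = 0
  · subst h0
    simp only [abs_zero, abs_le]
    refine ⟨⟨?_, ?_⟩, ?_⟩ <;> linarith
  obtain ⟨hp, h4⟩ := hus h0
  rw [← abs_mul] at hr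
  obtain ⟨hr1, -⟩ := abs_le.1 hr
  -- Thus `u r ≤ 2c ≤ (2/3) us r`. Dividing by `r`, which has the sign of `us`, shows that `u` has
  -- moved by at least `|us| / 3`; hence `|us| ≤ 3δ`.
  have h3 : 3 * c ≤ us * r := by linarith
  have hpr : 0 < us * r := by linarith
  have h23 : 3 * (u * r) ≤ 2 * (us * r) := by linarith
  rcases lt_or_gt_of_ne h0 with hneg | hpos
  · have hr0 : r < 0 := neg_of_mul_pos_right hpr hneg.le
    have : 2 * us ≤ 3 * u := by
      by_contra! hh
      nlinarith [mul_pos_of_neg_of_neg (sub_neg.2 hh) hr0]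
    simp only [abs_le]
    refine ⟨⟨?_, ?_⟩, ?_, ?_⟩ <;> linarith
  · have hr0 : 0 < r := (pos_iff_pos_of_mul_pos hpr).1 hpos
    have : 3 * u ≤ 2 * us := by
      by_contra! hh
      nlinarith [mul_pos (sub_pos.2 hh) hr0]
    simp only [abs_le]
    refine ⟨⟨?_, ?_⟩, ?_, ?_⟩ <;> linarith

/-- Every Fréchet subgradient at `θs` is close to one at `θ'` if the activation patterns agree and
`θ'` has no negative coefficients at its kinks. -/
theorem exists_subgradient_near {R B δ : ℝ} {Lloss Lgrad : ℝ≥0}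
    (hR : ∀ i, ‖x i‖ ≤ R) (hR0 : 0 ≤ R)
    (hdiff : ∀ i, Differentiable ℝ (fun t => ℓ t (y i)))
    (hloss : ∀ i, LipschitzWith Lloss (fun t => ℓ t (y i)))
    (hgrad : ∀ i, LipschitzWith Lgrad (deriv (fun t => ℓ t (y i))))
    {θs θ' : Params H d} (hB : ‖θs‖ ≤ B) (hδ : 0 ≤ δ) (hδB : 4 * δ ≤ B)
    (hpos : ∀ k i, 0 < preact x θ' k i → 0 < preact x θs k i)
    (hneg : ∀ k i, preact x θ' k i < 0 → preact x θs k i < 0)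
    (hu : ∀ k, |outer θ' k - outer θs k| ≤ 3 * δ)
    (hw : ∀ k, ‖hidden θ' k - hidden θs k‖ ≤ 2 * δ)
    (hkink : ∀ k i, preact x θ' k i = 0 → 0 ≤ outer θ' k * rho ℓ x y θ' i)
    {s : Params H d} (hs : s ∈ frechetSubdiff (empLoss ℓ x y) θs) :
    ∃ s' ∈ frechetSubdiff (empLoss ℓ x y) θ', ‖s' - s‖ ≤ curvConst N H R B Lloss Lgrad * δ := by
  have hB0 : 0 ≤ B := (norm_nonneg _).trans hB
  rw [mem_frechetSubdiff_iff hdiff] at hs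
  choose lam hlam hrep using fun k => exists_subgradient_representation (hs k).2
  set D : ℝ := Lgrad * (8 * H * R * B * δ) with hD
  have hD0 : 0 ≤ D := by positivity
  have hWs : ∀ k, ‖hidden θs k‖ ≤ B := fun k => (norm_hidden_le_norm θs k).trans hB
  have hUs : ∀ k, |outer θs k| ≤ B := fun k => (abs_outer_le_norm θs k).trans hB
  have hrho : ∀ i, |rho ℓ x y θ' i - rho ℓ x y θs i| ≤ D := fun i => by
    have hW' : ∀ k, ‖hidden θ' k‖ ≤ B + 2 * δ := fun k => by
      linarith [norm_le_norm_add_norm_sub' (hidden θ' k) (hidden θs k), hWs k, hw k]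
    have h1 := abs_netOut_sub_le (hR i) hu hw hW' hUs
    refine (abs_rho_sub_le hgrad θ' θs i).trans (mul_le_mul_of_nonneg_left (h1.trans ?_) (by simp))
    have : 3 * δ * (B + 2 * δ) + B * (2 * δ) ≤ 8 * B * δ := by nlinarith
    calc _ ≤ H * (R * (8 * B * δ)) := by gcongr
      _ = _ := by ring
  set c : ℝ := N * (R * Lloss) with hcdef
  have hc0 : 0 ≤ c := by positivity
  -- The weights `lam` chosen at `θs` are reused unchanged at `θ'`.
  set s' : Params H d := mkParams (fun k => ∑ i, rho ℓ x y θ' i * max (preact x θ' k i) 0)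
    (fun k => ∑ i, (outer θ' k * rho ℓ x y θ' i * lam k i) • x i) with hs'
  refine ⟨s', (mem_frechetSubdiff_iff hdiff _ _).2 fun k => ⟨rfl, fun v => ?_⟩, ?_⟩
  · simp only [hs', hidden_mkParams, sum_inner, real_inner_smul_left, mul_assoc _ (lam k _)]
    refine Finset.sum_le_sum fun i _ => ?_
    rw [real_inner_comm]
    exact ((hlam k i).congr (hpos k i) (hneg k i)).mul_le (hkink k i)
  have hout : ∀ k, |outer (s' - s) k| ≤ 2 * (c * δ) + N * (R * D) * ‖hidden θs k‖ := fun k => by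
    rw [outer_sub, (hs k).1, hs', outer_mkParams, ← Finset.sum_sub_distrib]
    refine (Finset.abs_sum_le_sum_abs _ _).trans ?_
    have hi : ∀ i, |rho ℓ x y θ' i * max (preact x θ' k i) 0 -
        rho ℓ x y θs i * max (preact x θs k i) 0| ≤
        Lloss * (2 * δ * R) + D * (‖hidden θs k‖ * R) := by
      intro i
      have h1 : |max (preact x θ' k i) 0 - max (preact x θs k i) 0| ≤ 2 * δ * R :=
        ((abs_relu_sub_relu_le _ _).trans (abs_preact_sub_le (hR i) θ' θs k)).trans
          (by gcongr; exact hw k)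
      have h2 : |max (preact x θs k i) 0| ≤ ‖hidden θs k‖ * R := by
        have := abs_relu_sub_relu_le (preact x θs k i) 0
        rw [max_self, sub_zero, sub_zero] at this
        exact this.trans (abs_preact_le (hR i) θs k)
      calc _ = |rho ℓ x y θ' i * (max (preact x θ' k i) 0 - max (preact x θs k i) 0) +
            (rho ℓ x y θ' i - rho ℓ x y θs i) * max (preact x θs k i) 0| := by congr 1; ring
        _ ≤ _ := by
          refine (abs_add_le _ _).trans (add_le_add ?_ ?_) <;> rw [abs_mul]
          · exact mul_le_mul (abs_rho_le hloss _ _) h1 (abs_nonneg _) (by simp)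
          · exact mul_le_mul (hrho i) h2 (abs_nonneg _) hD0
    refine (Finset.sum_le_sum fun i _ => hi i).trans (le_of_eq ?_)
    simp only [Finset.sum_const, Finset.card_univ, Fintype.card_fin, nsmul_eq_mul, hcdef]
    ring
  have hhid : ∀ k, ‖hidden (s' - s) k‖ ≤ 3 * (c * δ) + N * (R * D) * |outer θs k| := fun k => by
    rw [hidden_sub, hrep k, hs', hidden_mkParams, ← Finset.sum_sub_distrib]
    refine (norm_sum_le _ _).trans ?_
    have hi : ∀ i, ‖(outer θ' k * rho ℓ x y θ' i * lam k i) • x i -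
        (outer θs k * rho ℓ x y θs i * lam k i) • x i‖ ≤
        (3 * δ * Lloss + |outer θs k| * D) * R := by
      intro i
      obtain ⟨l0, l1, -⟩ := hlam k i
      rw [← sub_smul, norm_smul]
      refine mul_le_mul ?_ (hR i) (norm_nonneg _) (by positivity)
      rw [← sub_mul, norm_mul, Real.norm_of_nonneg l0]
      refine (mul_le_of_le_one_right (norm_nonneg _) l1).trans ?_
      calc _ = |(outer θ' k - outer θs k) * rho ℓ x y θ' i +
            outer θs k * (rho ℓ x y θ' i - rho ℓ x y θs i)| := by
              rw [Real.norm_eq_abs]; congr 1; ring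
        _ ≤ _ := by
          refine (abs_add_le _ _).trans (add_le_add ?_ ?_) <;> rw [abs_mul]
          · exact mul_le_mul (hu k) (abs_rho_le hloss _ _) (abs_nonneg _) (by positivity)
          · exact mul_le_mul_of_nonneg_left (hrho i) (abs_nonneg _)
    refine (Finset.sum_le_sum fun i _ => hi i).trans (le_of_eq ?_)
    simp only [Finset.sum_const, Finset.card_univ, Fintype.card_fin, nsmul_eq_mul, hcdef]
    ring
  set E : ℝ := N * (R * D) with hE
  have hE0 : 0 ≤ E := by positivity
  -- Keeping `‖w_k‖` and `|u_k|` separate lets their squares share one budget `B²`. The cross term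
  -- closes by Cauchy–Schwarz, as `4² + 6² ≤ 8²`, and the remaining term because `2² + 3² ≤ 4²`.
  have hnode : ∀ k, outer (s' - s) k ^ 2 + ‖hidden (s' - s) k‖ ^ 2 ≤
      (4 * (c * δ) + E * B) ^ 2 := fun k => by
    have h1 : outer (s' - s) k ^ 2 ≤ (2 * (c * δ) + E * ‖hidden θs k‖) ^ 2 := by
      rw [← sq_abs]
      gcongr
      exact hout k
    have h2 : ‖hidden (s' - s) k‖ ^ 2 ≤ (3 * (c * δ) + E * |outer θs k|) ^ 2 := by
      gcongr
      exact hhid k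
    have h3 : ‖hidden θs k‖ ^ 2 + |outer θs k| ^ 2 ≤ B ^ 2 := by
      rw [sq_abs, add_comm]
      exact (sq_outer_add_sq_hidden_le θs k).trans (by gcongr)
    have h4 : 4 * ‖hidden θs k‖ + 6 * |outer θs k| ≤ 8 * B := by
      refine le_of_sq_le_sq ?_ (by positivity)
      nlinarith [sq_nonneg (4 * |outer θs k| - 6 * ‖hidden θs k‖), sq_nonneg B]
    have h5 := mul_le_mul_of_nonneg_left h3 (sq_nonneg E)
    have h6 := mul_le_mul_of_nonneg_left h4 (by positivity : 0 ≤ c * δ * E)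
    nlinarith [sq_nonneg (c * δ)]
  refine (norm_params_le (by positivity) hnode).trans (le_of_eq ?_)
  simp only [hE, hD, hcdef, curvConst]
  ring

end

/-! ### Correctness of the rounding. -/

section

variable {N H d : ℕ} {ℓ : ℝ → ℝ → ℝ} {x : Fin N → EuclideanSpace ℝ (Fin d)} {y : Fin N → ℝ}

theorem existsUnique_isRndFOutput {R B δ : ℝ} {Lgrad : ℝ≥0} {θ : Params H d}
    (hne : ∀ k, (roundFeasible x R δ (hidden θ k)).Nonempty) :
    ∃! θ' : Params H d, IsRndFOutput ℓ x y R B Lgrad δ θ θ' := by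
  classical
  choose w hw huniq using fun k => existsUnique_nearest (hne k)
    (isClosed_roundFeasible R δ (hidden θ k)) (convex_roundFeasible R δ _) (hidden θ k)
  let u : Fin H → ℝ := fun k =>
    if ∃ i, inner ℝ (w k) (x i) = 0 ∧ outer θ k * rho ℓ x y θ i ≤ 2 * constCu H R B Lgrad * δ
    then 0 else outer θ k
  refine ⟨mkParams u w, fun k => ⟨hw k, ?_⟩, fun θ' h => ?_⟩
  · simp only [outer_mkParams, preact_mkParams, u]
    congr
  · have hw' : ∀ k, hidden θ' k = w k := fun k => huniq k _ (h k).1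
    refine params_ext (fun k => ?_) hw'
    rw [(h k).2, outer_mkParams]
    simp only [preact, hw', u]

/-- A weight near `ws` keeps the activation pattern of `ws` under the rounding, and `ws` itself is
feasible for the rounding. -/
theorem mem_roundFeasible_of_near {R δ : ℝ} (hR : ∀ i, ‖x i‖ ≤ R)
    (hRδ : Fin N → 0 < R * δ)
    {ws w : EuclideanSpace ℝ (Fin d)} (hw : ‖w - ws‖ ≤ δ)
    (hsep : ∀ i, inner ℝ ws (x i) ≠ 0 → 4 * R * δ ≤ |inner ℝ ws (x i)|) :
    ws ∈ roundFeasible x R δ w ∧ ∀ z ∈ roundFeasible x R δ w, ∀ i,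
      (0 < inner ℝ z (x i) → 0 < inner ℝ ws (x i)) ∧
      (inner ℝ z (x i) < 0 → inner ℝ ws (x i) < 0) ∧
      (inner ℝ z (x i) = 0 → inner ℝ ws (x i) = 0) := by
  have hd : ∀ i, |inner ℝ w (x i) - inner ℝ ws (x i)| ≤ R * δ := fun i => by
    rw [← inner_sub_left]
    refine (abs_real_inner_le_norm _ _).trans ?_
    rw [mul_comm]
    exact mul_le_mul (hR i) hw (norm_nonneg _) ((norm_nonneg _).trans (hR i))
  -- Preactivations move by at most `Rδ`: kinks stay within `Rδ`, while the others start at `4Rδ` or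
  -- more and stay beyond the threshold.
  have hcase : ∀ i, (4 * R * δ ≤ inner ℝ ws (x i) ∧ R * δ < inner ℝ w (x i)) ∨
      (inner ℝ ws (x i) ≤ -(4 * R * δ) ∧ inner ℝ w (x i) < -(R * δ)) ∨
      (inner ℝ ws (x i) = 0 ∧ |inner ℝ w (x i)| ≤ R * δ) := fun i => by
    have hp := hRδ i
    obtain ⟨h1, h2⟩ := abs_le.1 (hd i)
    by_cases h0 : inner ℝ ws (x i) = 0
    · refine Or.inr (Or.inr ⟨h0, ?_⟩)
      have := hd i
      rwa [h0, sub_zero] at this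
    · rcases le_abs.1 (hsep i h0) with h | h
      · exact Or.inl ⟨h, by linarith⟩
      · exact Or.inr (Or.inl ⟨by linarith, by linarith⟩)
  refine ⟨⟨fun i hi => ?_, fun i hi => ?_, fun i hi => ?_⟩, fun z hz i => ?_⟩
  · have hp := hRδ i
    rcases hcase i with ⟨h, h'⟩ | ⟨h, h'⟩ | ⟨h, h'⟩
    · linarith
    · linarith
    · linarith [(abs_le.1 h').2]
  · have hp := hRδ i
    rcases hcase i with ⟨h, h'⟩ | ⟨h, h'⟩ | ⟨h, h'⟩
    · linarith
    · linarith
    · linarith [(abs_le.1 h').1]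
  · rcases hcase i with ⟨h, h'⟩ | ⟨h, h'⟩ | ⟨h, h'⟩
    · linarith [(abs_le.1 hi).2]
    · linarith [(abs_le.1 hi).1]
    · exact h
  · have hp := hRδ i
    rcases hcase i with ⟨h, h'⟩ | ⟨h, h'⟩ | ⟨h, h'⟩
    · have := hz.1 i h'
      exact ⟨fun _ => by linarith, fun _ => by linarith, fun _ => by linarith⟩
    · have := hz.2.1 i h'
      exact ⟨fun _ => by linarith, fun _ => by linarith, fun _ => by linarith⟩
    · have := hz.2.2 i h'
      exact ⟨fun _ => by linarith, fun _ => by linarith, fun _ => h⟩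

theorem infEDist_zero_le_add {E : Type*} [NormedAddCommGroup E] {S S' : Set E} {M : ℝ}
    (h : ∀ s ∈ S, ∃ s' ∈ S', ‖s' - s‖ ≤ M) :
    Metric.infEDist 0 S' ≤ Metric.infEDist 0 S + ENNReal.ofReal M := by
  -- With `M` on the left this is a lower bound for an infimum, which also covers empty `S`.
  rw [← tsub_le_iff_right]
  refine Metric.le_infEDist.2 fun s hs => ?_
  obtain ⟨s', hs', hle⟩ := h s hs
  rw [tsub_le_iff_right]
  refine (Metric.infEDist_le_edist_of_mem hs').trans ((edist_triangle 0 s s').trans ?_)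
  gcongr
  rw [edist_comm, edist_dist, dist_eq_norm]
  exact ENNReal.ofReal_le_ofReal hle

theorem frechetSubdiff_nonempty_of_isFrechetStationary {E : Type*} [NormedAddCommGroup E]
    [InnerProductSpace ℝ E] {f : E → ℝ} {ε : ℝ} {p : E} (h : IsFrechetStationary f ε p) :
    (frechetSubdiff f p).Nonempty := by
  by_contra! he
  rw [IsFrechetStationary, he, Metric.infEDist_empty] at h
  exact absurd h (by simp)

theorem outer_mul_rho_nonneg (hx : ∀ i, x i ≠ 0)
    (hdiff : ∀ i, Differentiable ℝ (fun t => ℓ t (y i))) {θ : Params H d}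
    (hne : (frechetSubdiff (empLoss ℓ x y) θ).Nonempty) (hSQ : SpanQualification ℓ x y θ)
    {k : Fin H} {i : Fin N} (hki : preact x θ k i = 0) :
    0 ≤ outer θ k * rho ℓ x y θ i := by
  obtain ⟨s, hs⟩ := hne
  exact coeff_nonneg_of_linear_minorant hx ((mem_frechetSubdiff_iff hdiff _ _).1 hs k).2 (hSQ k) hki

/-- A single nonzero preactivation suffices: it is at least `4Rδ` and at most `BR`. -/
theorem four_mul_le_bound {R B δ : ℝ} {Lgrad : ℝ≥0} {θs : Params H d}
    (hx : ∀ i, x i ≠ 0) (hR : ∀ i, ‖x i‖ ≤ R) (hB : ‖θs‖ ≤ B)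
    (hδτ : ENNReal.ofReal δ ≤ sepConst ℓ x y R B Lgrad θs)
    (hδB : (∀ i k, preact x θs k i = 0) → 4 * δ ≤ B) : 4 * δ ≤ B := by
  by_cases h : ∀ i k, preact x θs k i = 0
  · exact hδB h
  push Not at h
  obtain ⟨i, k, hik⟩ := h
  have hR0 : 0 < R := (norm_pos_iff.2 (hx i)).trans_le (hR i)
  have h1 := four_mul_le_abs_preact hR0 hδτ hik
  have h2 := abs_preact_le (hR i) θs k
  have h3 : ‖hidden θs k‖ * R ≤ B * R := by
    gcongr
    exact (norm_hidden_le_norm θs k).trans hB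
  exact le_of_mul_le_mul_right (by linarith) hR0

/-- The weights of a rounding of `θ` are close to those of `θ` and `θs`, and there are no negative
coefficients at its kinks. -/
theorem isRndFOutput_bounds {R B δ : ℝ} {Lgrad : ℝ≥0}
    (hR : ∀ i, ‖x i‖ ≤ R) (hR0 : 0 < R)
    (hgrad : ∀ i, LipschitzWith Lgrad (deriv (fun t => ℓ t (y i))))
    {θs θ θ' : Params H d} (hB : ‖θs‖ ≤ B) (hδ : 0 < δ) (hδB : 4 * δ ≤ B)
    (hδτ : ENNReal.ofReal δ ≤ sepConst ℓ x y R B Lgrad θs)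
    (hnd : Nondegenerate ℓ x y θs) (hθ : ‖θ - θs‖ ≤ δ)
    (hsgn : ∀ k i, preact x θs k i = 0 → 0 ≤ outer θs k * rho ℓ x y θs i)
    (hfeas : ∀ k, hidden θs k ∈ roundFeasible x R δ (hidden θ k))
    (hzero : ∀ k i, preact x θ' k i = 0 → preact x θs k i = 0)
    (hθ' : IsRndFOutput ℓ x y R B Lgrad δ θ θ') :
    (∀ k, |outer θ' k - outer θs k| ≤ 3 * δ) ∧
    (∀ k, ‖hidden θ' k - hidden θs k‖ ≤ 2 * δ) ∧
    ∀ k i, preact x θ' k i = 0 → 0 ≤ outer θ' k * rho ℓ x y θ' i := by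
  have hB0 : 0 ≤ B := (norm_nonneg _).trans hB
  have hC : 0 ≤ constCu H R B Lgrad := by unfold constCu; positivity
  have hUs : ∀ k, |outer θs k| ≤ B := fun k => (abs_outer_le_norm θs k).trans hB
  have hWs : ∀ k, ‖hidden θs k‖ ≤ B := fun k => (norm_hidden_le_norm θs k).trans hB
  have hu : ∀ k, |outer θ k - outer θs k| ≤ δ := fun k =>
    (abs_outer_le_norm (θ - θs) k).trans hθ
  have hw : ∀ k, ‖hidden θ k - hidden θs k‖ ≤ δ := fun k =>
    (norm_hidden_le_norm (θ - θs) k).trans hθ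
  have hU : ∀ k, |outer θ k| ≤ B + δ := fun k => by
    linarith [abs_sub_abs_le_abs_sub (outer θ k) (outer θs k), hu k, hUs k]
  have hW : ∀ k, ‖hidden θ k‖ ≤ B + δ := fun k => by
    linarith [norm_le_norm_add_norm_sub' (hidden θ k) (hidden θs k), hw k, hWs k]
  -- The weight of `θs` competes in the minimization, so the minimizer is at least as close to that
  -- of `θ`.
  have hw1 : ∀ k, ‖hidden θ' k - hidden θ k‖ ≤ δ := fun k => by
    refine (le_of_sq_le_sq ((hθ' k).1.2 _ (hfeas k)) (norm_nonneg _)).trans ?_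
    rw [norm_sub_rev]
    exact hw k
  have hw2 : ∀ k, ‖hidden θ' k - hidden θs k‖ ≤ 2 * δ := fun k => by
    linarith [norm_sub_le_norm_sub_add_norm_sub (hidden θ' k) (hidden θ k) (hidden θs k),
      hw1 k, hw k]
  have hW' : ∀ k, ‖hidden θ' k‖ ≤ B + 2 * δ := fun k => by
    linarith [norm_le_norm_add_norm_sub' (hidden θ' k) (hidden θs k), hw2 k, hWs k]
  have hrs : ∀ k i, |outer θs k| * |rho ℓ x y θ i - rho ℓ x y θs i| ≤
      constCu H R B Lgrad * δ := fun k i => by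
    have h1 : δ * (B + δ) + B * δ ≤ 4 * B * δ := by nlinarith
    calc |outer θs k| * |rho ℓ x y θ i - rho ℓ x y θs i|
        ≤ B * (Lgrad * (H * (R * (δ * (B + δ) + B * δ)))) := by
          gcongr
          · exact hUs k
          · exact (abs_rho_sub_le hgrad θ θs i).trans
              (by gcongr; exact abs_netOut_sub_le (hR i) hu hw hW hUs)
      _ ≤ B * (Lgrad * (H * (R * (4 * B * δ)))) := by gcongr
      _ = Lgrad * (4 * H * R * B ^ 2) * δ := by ring
      _ ≤ constCu H R B Lgrad * δ := by
          unfold constCu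
          gcongr
          linarith
  have hcase : ∀ k, (outer θ' k = outer θ k ∧ ∀ i, preact x θ' k i = 0 →
        2 * constCu H R B Lgrad * δ < outer θ k * rho ℓ x y θ i) ∨
      (outer θ' k = 0 ∧ |outer θ k| ≤ 2 * δ ∧ |outer θs k| ≤ 3 * δ) := by
    intro k
    have h := (hθ' k).2
    split_ifs at h with hex
    · obtain ⟨i, hi, hle⟩ := hex
      refine Or.inr ⟨h, outer_small_of_mul_le hδ.le (fun h0 => ?_) (hu k) (hrs k i)
        (hle.trans_eq (by ring))⟩
      have hki := hzero k i hi
      -- Nondegeneracy excludes a vanishing `ρ`, so the separation constant applies as soon as the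
      -- outer weight is nonzero.
      have hpos : 0 < outer θs k * rho ℓ x y θs i :=
        lt_of_le_of_ne (hsgn k i hki) (mul_ne_zero h0 (hnd i ⟨k, hki⟩)).symm
      exact ⟨hpos, by linarith [four_mul_le_outer_mul_rho hC hδτ hki hpos]⟩
    · push Not at hex
      exact Or.inl ⟨h, hex⟩
  refine ⟨fun k => ?_, hw2, fun k i hki => ?_⟩
  · rcases hcase k with ⟨h, -⟩ | ⟨h, -, h3⟩
    · rw [h]
      linarith [hu k]
    · rwa [h, zero_sub, abs_neg]
  · rcases hcase k with ⟨h, hgt⟩ | ⟨h, -, -⟩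
    · have hu' : ∀ k, |outer θ' k - outer θ k| ≤ 2 * δ := fun k => by
        rcases hcase k with ⟨h, -⟩ | ⟨h, h2, -⟩
        · rw [h, sub_self, abs_zero]
          positivity
        · rwa [h, zero_sub, abs_neg]
      -- For a surviving weight, the margin `2 C_u δ` must absorb the change of `ρ` between `θ` and
      -- `θ'`. With `δ ≤ B/4` the factor is `5/4 · 17/4 = 85/16 ≤ 8`.
      have h1 : (B + δ) * (2 * δ * (B + 2 * δ) + (B + δ) * δ) ≤ 8 * B ^ 2 * δ := by
        have e1 : 2 * δ * (B + 2 * δ) + (B + δ) * δ ≤ 17 / 4 * B * δ := by nlinarith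
        calc _ ≤ (B + B / 4) * (17 / 4 * B * δ) := by gcongr; linarith
          _ = 85 / 16 * (B ^ 2 * δ) := by ring
          _ ≤ 8 * (B ^ 2 * δ) := by gcongr; norm_num
          _ = _ := by ring
      have h2 : |outer θ k| * |rho ℓ x y θ' i - rho ℓ x y θ i| ≤
          2 * constCu H R B Lgrad * δ := by
        calc |outer θ k| * |rho ℓ x y θ' i - rho ℓ x y θ i|
            ≤ (B + δ) * (Lgrad * (H * (R * (2 * δ * (B + 2 * δ) + (B + δ) * δ)))) := by
              gcongr
              · exact hU k
              · exact (abs_rho_sub_le hgrad θ' θ i).trans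
                  (by gcongr; exact abs_netOut_sub_le (hR i) hu' hw1 hW' hU)
          _ = Lgrad * H * R * ((B + δ) * (2 * δ * (B + 2 * δ) + (B + δ) * δ)) := by ring
          _ ≤ Lgrad * H * R * (8 * B ^ 2 * δ) := by gcongr
          _ = 2 * (Lgrad * (4 * H * R * B ^ 2)) * δ := by ring
          _ ≤ 2 * constCu H R B Lgrad * δ := by
              unfold constCu
              gcongr
              linarith
      rw [← abs_mul] at h2
      rw [h]
      linarith [(abs_le.1 h2).1, hgt i hki]
    · rw [h, zero_mul]

end

end ReLUNet

theorem theorem6 {N H d : ℕ} (ℓ : ℝ → ℝ → ℝ)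
    (x : Fin N → EuclideanSpace ℝ (Fin d)) (y : Fin N → ℝ)
    (R : ℝ) (Lloss Lgrad : ℝ≥0)
    (hx : ∀ i, x i ≠ 0) (hR : ∀ i, ‖x i‖ ≤ R)
    (hdiff : ∀ i, Differentiable ℝ (fun t => ℓ t (y i)))
    (hloss : ∀ i, LipschitzWith Lloss (fun t => ℓ t (y i)))
    (hgrad : ∀ i, LipschitzWith Lgrad (deriv (fun t => ℓ t (y i))))
    (ε : ℝ) (hε : 0 ≤ ε)
    (θs : ReLUNet.Params H d) (B : ℝ) (hB : ‖θs‖ ≤ B)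
    (hstat : ReLUNet.IsFrechetStationary (ReLUNet.empLoss ℓ x y) ε θs)
    (hSQ : ReLUNet.SpanQualification ℓ x y θs)
    (hnd : ReLUNet.Nondegenerate ℓ x y θs)
    (δ : ℝ) (hδ : 0 < δ)
    (hδτ : ENNReal.ofReal δ ≤ ReLUNet.sepConst ℓ x y R B Lgrad θs)
    (hδB : (∀ i k, ReLUNet.preact x θs k i = 0) → 4 * δ ≤ B)
    (θ : ReLUNet.Params H d) (hθ : ‖θ - θs‖ ≤ δ) :
    (∃! θ' : ReLUNet.Params H d, ReLUNet.IsRndFOutput ℓ x y R B Lgrad δ θ θ') ∧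
    ∀ θ' : ReLUNet.Params H d, ReLUNet.IsRndFOutput ℓ x y R B Lgrad δ θ θ' →
      ReLUNet.SpanQualification ℓ x y θ' →
      Metric.infEDist 0 (ReLUNet.frechetSubdiff (ReLUNet.empLoss ℓ x y) θ') ≤
        ENNReal.ofReal (ε + ReLUNet.curvConst N H R B Lloss Lgrad * δ) := by
  -- Positivity of `R` comes from a nonzero data point, so it is stated conditionally on having one.
  have hRδ : Fin N → 0 < R * δ := fun i =>
    mul_pos ((norm_pos_iff.2 (hx i)).trans_le (hR i)) hδ
  have hnear := fun k => ReLUNet.mem_roundFeasible_of_near (w := ReLUNet.hidden θ k) hR hRδ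
    ((ReLUNet.norm_hidden_le_norm (θ - θs) k).trans hθ) fun i hi =>
      ReLUNet.four_mul_le_abs_preact ((norm_pos_iff.2 (hx i)).trans_le (hR i)) hδτ hi
  refine ⟨ReLUNet.existsUnique_isRndFOutput fun k => ⟨_, (hnear k).1⟩, fun θ' hθ' _ => ?_⟩
  -- Without data the loss is constant and `0` is a subgradient.
  rcases isEmpty_or_nonempty (Fin N) with hN | ⟨⟨i₀⟩⟩
  · have h0 : (0 : ReLUNet.Params H d) ∈ ReLUNet.frechetSubdiff (ReLUNet.empLoss ℓ x y) θ' :=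
      (ReLUNet.mem_frechetSubdiff_iff_forall hdiff _ _).2 fun v => by simp
    rw [Metric.infEDist_zero_of_mem h0]
    exact zero_le
  have hR0 : 0 < R := (norm_pos_iff.2 (hx i₀)).trans_le (hR i₀)
  have hδB' := ReLUNet.four_mul_le_bound hx hR hB hδτ hδB
  have hB0 : 0 ≤ B := (norm_nonneg _).trans hB
  have hpat := fun k => (hnear k).2 _ (hθ' k).1.1
  obtain ⟨hu, hw, hkink⟩ := ReLUNet.isRndFOutput_bounds hR hR0 hgrad hB hδ hδB' hδτ hnd hθ
    (fun k i hki => ReLUNet.outer_mul_rho_nonneg hx hdiff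
      (ReLUNet.frechetSubdiff_nonempty_of_isFrechetStationary hstat) hSQ hki)
    (fun k => (hnear k).1) (fun k i => (hpat k i).2.2) hθ'
  refine (ReLUNet.infEDist_zero_le_add fun s hs => ReLUNet.exists_subgradient_near hR hR0.le hdiff
    hloss hgrad hB hδ.le hδB' (fun k i => (hpat k i).1) (fun k i => (hpat k i).2.1) hu hw hkink
    hs).trans ?_
  rw [ENNReal.ofReal_add hε (by unfold ReLUNet.curvConst; positivity)]
  gcongr
  exact hstat
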